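/- All graphs are finite and simple, and uniqueness of graphs is up to isomorphism. For a graph $G$ with Laplacian matrix $L(G)$ (degree matrix minus adjacency matrix) let $\ell_k(G)=\operatorname{tr}(L(G)^k)$ for $k\ge 1$; let $n(G)$ be its number of vertices and $t(G)$ its number of spanning trees. Let $\mathcal{S}(G)$ (resp. $\mathcal{R}(G)$) be the class of all (resp. all regular) graphs with as many vertices and edges as $G$. A $d$-regular graph $G$ on $n$ vertices is *$\mathcal{L}$-trace-minimal* if for every $d$-regular graph $H$ on $n$ vertices either $\ell_k(G)=\ell_k(H)$ for all $k\ge 1$, or there is $j\ge 1$ such that $\ell_k(G)\le\ell_k(H)$ for $1\le k<j$ and $\ell_j(G)<\ell_j(H)$. A graph $G$ is *$t$-optimal* if $t(G)\ge t(H)$ for every $H\in\mathcal{S}(G)$. Let $G_0$ be a $d$-regular graph, and for each integer $p\ge 0$ let $G_0(p)=G_0\cup pK_{d+1}$ be the disjoint union of $G_0$ and $p$ copies of the complete graph $K_{d+1}$. Assume that, for every $p\ge 0$, $G_0(p)$ is the only $\mathcal{L}$-trace-minimal graph in $\mathcal{R}(G_0(p))$. Then there exists $n_0$ such that, for every $p\ge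 0$ with $n(G_0(p))\ge n_0$, the complement $\overline{G_0(p)}$ is the only $t$-optimal graph in $\mathcal{S}(\overline{G_0(p)})$. -/

import Mathlib

/-- The class `R_d(n)` of `d`-regular graphs, realised on an `n`-element vertex type `V`.
Every graph with `n` vertices is isomorphic to one on `V`. -/
def regularClass (V : Type*) [Fintype V] (d : ℕ) : Set (SimpleGraph V) :=
  open Classical in {G | G.IsRegularOfDegree d}

/-- The class `S(G)` of simple graphs with as many vertices and edges as `G`
(realised on the vertex type of `G`, hence up to isomorphism). -/
def sizeClass {V : Type*} [Fintype V] (G : SimpleGraph V) : Set (SimpleGraph V) :=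
  {H | H.edgeSet.ncard = G.edgeSet.ncard}

/-- The class `R(G)` of regular graphs with as many vertices and edges as `G`. -/
def regularSizeClass {V : Type*} [Fintype V] (G : SimpleGraph V) : Set (SimpleGraph V) :=
  {H | (∃ e : ℕ, H ∈ regularClass V e) ∧ H ∈ sizeClass G}

/-- The Laplacian sequence `ℓ_k(G) = tr (L(G)^k)`. -/
noncomputable def lapSeq {V : Type*} [Fintype V] (G : SimpleGraph V) (k : ℕ) : ℝ :=
  open Classical in ((G.lapMatrix ℝ) ^ k).trace

/-- The lexicographic order `b ⪯ c` on real sequences indexed by the positive integers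
(the values at `0` are ignored). The two alternatives exclude each other. -/
def SeqLexLE (b c : ℕ → ℝ) : Prop :=
  (∀ i, 1 ≤ i → b i = c i) ∨
    ∃ j, 1 ≤ j ∧ (∀ i, 1 ≤ i → i < j → b i ≤ c i) ∧ b j < c j

/-- A `d`-regular graph `G` on `n` vertices is `L`-trace-minimal if its Laplacian sequence
is lexicographically minimal among all `d`-regular graphs on `n` vertices. -/
def IsLTraceMinimal {V : Type*} [Fintype V] (G : SimpleGraph V) : Prop :=
  ∃ d : ℕ, G ∈ regularClass V d ∧ ∀ H ∈ regularClass V d, SeqLexLE (lapSeq G) (lapSeq H)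

/-- The number `t(G)` of spanning trees of `G`. -/
noncomputable def numSpanningTrees {V : Type*} [Fintype V] (G : SimpleGraph V) : ℕ :=
  {T : SimpleGraph V | T ≤ G ∧ T.IsTree}.ncard

/-- `G` is `t`-optimal if it has the most spanning trees among all simple graphs with as many
vertices and edges. -/
def IsTOptimal {V : Type*} [Fintype V] (G : SimpleGraph V) : Prop :=
  ∀ H ∈ sizeClass G, numSpanningTrees H ≤ numSpanningTrees G

/-- The disjoint union `p K_m` of `p` complete graphs on `m` vertices. -/
def completeCopies (p m : ℕ) : SimpleGraph (Fin p × Fin m) where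
  Adj x y := x.1 = y.1 ∧ x.2 ≠ y.2
  symm := ⟨fun _ _ h => ⟨h.1.symm, h.2.symm⟩⟩
  loopless := ⟨fun _ h => h.2 rfl⟩

/-- The graph `G₀(p) = G₀ ∪ p K_{d+1}` (disjoint union). -/
def addCompleteCopies {V : Type*} (G₀ : SimpleGraph V) (d p : ℕ) :
    SimpleGraph (V ⊕ (Fin p × Fin (d + 1))) :=
  SimpleGraph.sum G₀ (completeCopies p (d + 1))

/-- Up to isomorphism, `G` is the only member of the class `C` with the property `P`. -/
def IsOnlyIn {V : Type*} (C : Set (SimpleGraph V)) (P : SimpleGraph V → Prop)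
    (G : SimpleGraph V) : Prop :=
  (G ∈ C ∧ P G) ∧ ∀ H ∈ C, P H → Nonempty (H ≃g G)

/-! Write `n` for the number of vertices of `G = G₀(p)`. Since `L(Fᶜ) + J = n - L(F)`, the matrix
tree theorem gives `n² t(Fᶜ) = ∏ (n - λᵢ(F))`, whose logarithm expands as `n log n - ∑ ℓ_k(F) / (k
n^k)`. Maximising `t(Fᶜ)` for large `n` should thus amount to minimising the sequence `ℓ_k(F)`
lexicographically. If `F` first differs from `G` at `k`, then `k ≥ 2` because `ℓ₁` counts edges, and
`ℓ_k(F) ≥ ℓ_k(G) + 1`: regular graphs minimise `ℓ₂`, trace-minimality covers later `k`, and traces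
are integers.

The difficulty is uniformity in `p`, as `n` and the traces grow together. The copies of `K_{d+1}`
only have eigenvalues `0` and `c = d + 1`, so the moments `∑ λ^(k-1) (λ - c)²` of `G` do not depend
on `p`. They are nonnegative for `F`, which bounds `ℓ_{k+1}(F) - ℓ_{k+1}(G)` below by a constant;
later terms for `F` have a favourable sign, and those for `G` are small since its eigenvalues are
bounded (`prod_sub_lt_prod_sub`). Finally `k` itself is bounded: the integral positive semidefinite
matrix `(L - c) L (L - c)` has rank at most its trace, leaving boundedly many eigenvalues outside
`{0, c}` (`card_lapEig_le`), so finitely many traces determine the rest (`lapSeq_eq_of_forall_le`).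
If all traces agree, uniqueness of the minimiser gives an isomorphism. -/

/-! ### The matrix tree theorem, by expansion over parent functions. -/

section MatrixTree

open scoped Classical
open Matrix

variable {V : Type*}

/-- Parent functions of spanning trees of `G` rooted at `r`. -/
def parentFunctions (G : SimpleGraph V) (r : V) : Set (V → V) :=
  {f | f r = r ∧ (∀ v, v ≠ r → G.Adj v (f v)) ∧ ∀ v, ∃ k, f^[k] v = r}

/-- The graph whose edges join each `v ≠ r` to `f v`. -/
def parentGraph (f : V → V) (r : V) : SimpleGraph V :=
  SimpleGraph.fromEdgeSet ((fun v => s(v, f v)) '' {v | v ≠ r})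

theorem parentGraph_adj_parent {G : SimpleGraph V} {r : V} {f : V → V}
    (hf : f ∈ parentFunctions G r) {v : V} (hv : v ≠ r) : (parentGraph f r).Adj v (f v) := by
  rw [parentGraph, SimpleGraph.fromEdgeSet_adj]
  exact ⟨⟨v, hv, rfl⟩, (hf.2.1 v hv).ne⟩

theorem parentGraph_adj_iff {G : SimpleGraph V} {r : V} {f : V → V}
    (hf : f ∈ parentFunctions G r) {u w : V} :
    (parentGraph f r).Adj u w ↔ (u ≠ r ∧ f u = w) ∨ (w ≠ r ∧ f w = u) := by
  constructor
  · intro h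
    rw [parentGraph, SimpleGraph.fromEdgeSet_adj] at h
    obtain ⟨⟨v, hv, he⟩, -⟩ := h
    rw [Sym2.eq_iff] at he
    rcases he with ⟨rfl, h⟩ | ⟨rfl, h⟩
    · exact Or.inl ⟨hv, h⟩
    · exact Or.inr ⟨hv, h⟩
  · rintro (⟨h, rfl⟩ | ⟨h, rfl⟩)
    · exact parentGraph_adj_parent hf h
    · exact (parentGraph_adj_parent hf h).symm

theorem parentGraph_le {G : SimpleGraph V} {r : V} {f : V → V}
    (hf : f ∈ parentFunctions G r) : parentGraph f r ≤ G := by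
  intro u w h
  rcases (parentGraph_adj_iff hf).mp h with ⟨hu, rfl⟩ | ⟨hw, rfl⟩
  · exact hf.2.1 _ hu
  · exact (hf.2.1 _ hw).symm

theorem not_reaches_of_two_cycle {f : V → V} {r v : V} (hv : v ≠ r) (hfv : f v ≠ r)
    (h : f (f v) = v) (k : ℕ) : f^[k] v ≠ r ∧ f^[k] (f v) ≠ r := by
  induction k with
  | zero => exact ⟨hv, hfv⟩
  | succ k ih =>
    rw [Function.iterate_succ_apply, Function.iterate_succ_apply, h]
    exact ih.symm

/-- If `f w ≠ g w`, the common edge from `w` to `f w` must come from `g (f w) = w`. Then `f` and `g`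
differ at `f w` too, as otherwise `f` has a 2-cycle. Hence the `f`-orbit never reaches `r`. -/
theorem parentGraph_injOn (G : SimpleGraph V) (r : V) :
    Set.InjOn (fun f => parentGraph f r) (parentFunctions G r) := by
  intro f hf g hg hfg
  by_contra hne
  obtain ⟨v, hv⟩ := Function.ne_iff.mp hne
  have key : ∀ k, f^[k] v ≠ r ∧ f (f^[k] v) ≠ g (f^[k] v) := by
    intro k
    induction k with
    | zero =>
      refine ⟨?_, hv⟩
      rintro h
      rw [Function.iterate_zero_apply] at h
      rw [h, hf.1, hg.1] at hv
      exact hv rfl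
    | succ k ih =>
      rw [Function.iterate_succ_apply']
      set w := f^[k] v
      have hadj : (parentGraph g r).Adj w (f w) := by
        have := parentGraph_adj_parent hf ih.1
        simp only at hfg
        rwa [hfg] at this
      rcases (parentGraph_adj_iff hg).mp hadj with ⟨_, h⟩ | ⟨h1, h2⟩
      · exact absurd h.symm ih.2
      · refine ⟨h1, fun h => ?_⟩
        obtain ⟨m, hm⟩ := hf.2.2 w
        exact (not_reaches_of_two_cycle ih.1 h1 (h.trans h2) m).1 hm
  obtain ⟨k, hk⟩ := hf.2.2 v
  exact (key k).1 hk

variable [Fintype V]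

/-- The real Laplacian matrix of a graph. -/
noncomputable def lap (G : SimpleGraph V) : Matrix V V ℝ := G.lapMatrix ℝ

/-- Summing all rows into row `r` yields one factor `n` and a row of ones, which clears `J` from the
other rows. Summing all columns into column `r` yields the second factor and a principal cofactor.
-/
theorem det_add_one_of_sum_eq_zero (M : Matrix V V ℝ) (hrow : ∀ i, ∑ j, M i j = 0)
    (hcol : ∀ j, ∑ i, M i j = 0) (r : V) :
    (M + of fun _ _ => 1).det =
      (Fintype.card V : ℝ) ^ 2 * (M.updateRow r (Pi.single r 1)).det := by
  have h1 : (M + of fun _ _ => (1 : ℝ)).det =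
      (Fintype.card V : ℝ) * ((M + of fun _ _ => (1 : ℝ)).updateRow r (fun _ => 1)).det := by
    have h := det_updateRow_sum (M + of fun _ _ => (1 : ℝ)) r (fun _ => 1)
    rw [one_smul] at h
    set N : Matrix V V ℝ := M + of fun _ _ => (1 : ℝ) with hN
    have hs : ∑ k, (fun _ => (1 : ℝ)) k • N k = (Fintype.card V : ℝ) • fun _ => (1 : ℝ) := by
      ext j
      have he : ∀ k, N k j = M k j + 1 := fun _ => rfl
      refine (Finset.sum_apply j _ _).trans ?_
      simp [he, Finset.sum_add_distrib, hcol]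
    rw [← h, hs, det_updateRow_smul]
  have h2 : ((M + of fun _ _ => (1 : ℝ)).updateRow r (fun _ => 1)).det =
      (M.updateRow r (fun _ => 1)).det := by
    refine det_eq_of_forall_row_eq_smul_add_const (fun i => if i = r then 0 else 1) r (by simp) ?_
    intro i j
    by_cases h : i = r
    · subst h; simp
    · simp [h]
  have h3 : (M.updateRow r (fun _ => (1 : ℝ))).det =
      (Fintype.card V : ℝ) * (M.updateRow r (Pi.single r 1)).det := by
    set B := M.updateRow r (fun _ => (1 : ℝ)) with hB
    have h := det_updateCol_sum B r (fun _ => 1)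
    rw [one_smul] at h
    have hs : (fun k => ∑ i, (fun _ => (1 : ℝ)) i • B k i) =
        (Fintype.card V : ℝ) • (Pi.single r 1 : V → ℝ) := by
      ext k
      by_cases hk : k = r
      · subst hk; simp [hB]
      · simp [hB, hrow, hk]
    have hadj : (B.updateCol r (Pi.single r 1)).det = (B.updateRow r (Pi.single r 1)).det := by
      rw [← adjugate_apply, ← det_transpose, ← updateRow_transpose, ← adjugate_apply,
        ← adjugate_transpose, transpose_apply]
    rw [← h, hs, det_updateCol_smul, hadj, hB, updateRow_idem]
  rw [h1, h2, h3]
  ring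

/-- The rows of the identity minus a functional graph rooted at `r`. -/
noncomputable def rootedMatrix (f : V → V) (r : V) : Matrix V V ℝ :=
  of fun v => if v = r then Pi.single r 1 else Pi.single v 1 - Pi.single (f v) 1

/-- Ordering vertices by their number of steps to `r` makes the matrix unitriangular. -/
theorem det_rootedMatrix_of_reaches (f : V → V) (r : V) (hf : ∀ v, ∃ k, f^[k] v = r) :
    (rootedMatrix f r).det = 1 := by
  let b : V → ℕ := fun v => Nat.find (hf v)
  have hb : ∀ v, v ≠ r → b (f v) < b v := by
    intro v hv
    have h1 : f^[b v] v = r := Nat.find_spec (hf v)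
    have h0 : b v ≠ 0 := by
      intro h
      rw [h] at h1
      exact hv h1
    obtain ⟨m, hm⟩ := Nat.exists_eq_succ_of_ne_zero h0
    have : b (f v) ≤ m := by
      refine Nat.find_min' (hf (f v)) ?_
      rw [hm, Function.iterate_succ_apply] at h1
      exact h1
    omega
  have hT : (rootedMatrix f r)ᵀ.BlockTriangular b := by
    intro i j hij
    have hne : i ≠ j := by rintro rfl; exact lt_irrefl _ hij
    simp only [transpose_apply, rootedMatrix, of_apply]
    by_cases hj : j = r
    · subst hj; simp [hne]
    · have : i ≠ f j := by
        rintro rfl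
        exact absurd (hb j hj) (not_lt.mpr hij.le)
      simp [hj, hne, this]
  rw [← det_transpose, hT.det]
  refine Finset.prod_eq_one fun a _ => ?_
  suffices h : (rootedMatrix f r)ᵀ.toSquareBlock b a = 1 by rw [h, det_one]
  ext ⟨i, hi⟩ ⟨j, hj⟩
  simp only [toSquareBlock_def, of_apply, transpose_apply, rootedMatrix, one_apply,
    Subtype.mk.injEq]
  by_cases hjr : j = r
  · subst hjr; simp [Pi.single_apply]
  · have : i ≠ f j := by
      rintro rfl
      have := hb j hjr
      omega
    simp [hjr, this, Pi.single_apply]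

/-- The indicator of the vertices that never reach `r` lies in the kernel. -/
theorem det_rootedMatrix_of_not_reaches (f : V → V) (r : V) (hf : ¬ ∀ v, ∃ k, f^[k] v = r) :
    (rootedMatrix f r).det = 0 := by
  rw [← exists_mulVec_eq_zero_iff]
  push Not at hf
  obtain ⟨w, hw⟩ := hf
  refine ⟨fun v => if ∀ k, f^[k] v ≠ r then 1 else 0, ?_, ?_⟩
  · intro h
    have := congrFun h w
    rw [if_pos hw] at this
    simp at this
  · ext v
    by_cases hv : v = r
    · subst hv
      have : ¬ ∀ k, f^[k] v ≠ v := fun h => h 0 rfl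
      simp [rootedMatrix, mulVec, this]
    · have : (∀ k, f^[k] v ≠ r) ↔ ∀ k, f^[k] (f v) ≠ r := by
        constructor
        · intro h k
          exact h (k + 1)
        · intro h k
          cases k with
          | zero => exact hv
          | succ k => exact h k
      change (rootedMatrix f r v) ⬝ᵥ _ = 0
      have hrow : rootedMatrix f r v = Pi.single v 1 - Pi.single (f v) 1 := by
        simp only [rootedMatrix]
        exact if_neg hv
      rw [hrow, sub_dotProduct, single_dotProduct, single_dotProduct]
      simp only [this, sub_self]

theorem lap_apply (G : SimpleGraph V) (i j : V) :
    lap G i j = (if i = j then ∑ k, (if G.Adj i k then 1 else 0) else 0) -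
      (if G.Adj i j then 1 else 0) := by
  simp only [lap, SimpleGraph.lapMatrix, SimpleGraph.degMatrix, Matrix.sub_apply, diagonal_apply,
    SimpleGraph.adjMatrix_apply, SimpleGraph.degree_eq_sum_if_adj]

theorem lap_row (G : SimpleGraph V) (v : V) :
    lap G v = ∑ j, if G.Adj v j then Pi.single v 1 - Pi.single j 1 else 0 := by
  ext u
  rw [lap_apply, Finset.sum_apply]
  have : ∀ c, (if G.Adj v c then (Pi.single v 1 - Pi.single c 1 : V → ℝ) else 0) u =
      (if v = u then (if G.Adj v c then 1 else 0) else 0) -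
        (if c = u then (if G.Adj v c then 1 else 0) else 0) := by
    intro c
    by_cases h : G.Adj v c <;> simp [h, Pi.single_apply, eq_comm]
  simp only [this, Finset.sum_sub_distrib]
  by_cases h : v = u <;> simp [h]

theorem det_updateRow_lap (G : SimpleGraph V) (r : V) :
    ((lap G).updateRow r (Pi.single r 1)).det = (parentFunctions G r).ncard := by
  -- Each row is a sum over neighbours, so multilinearity turns the determinant into a sum over
  -- functions `f`. In row `r` only the choice `r` is nonzero, which forces `f r = r`.
  let g : V → V → V → ℝ := fun v j =>
    if v = r then (if j = r then Pi.single r 1 else 0)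
    else if G.Adj v j then Pi.single v 1 - Pi.single j 1 else 0
  have h1 : (lap G).updateRow r (Pi.single r 1) = fun v => ∑ j, g v j := by
    funext v
    by_cases hv : v = r
    · subst hv; simp [g]
    · rw [updateRow_ne hv, lap_row]; simp [g, hv]
  have h2 : ((lap G).updateRow r (Pi.single r 1)).det =
      ∑ f : V → V, det (of fun v => g v (f v)) := by
    rw [h1]
    exact (detRowAlternating (n := V) (R := ℝ)).toMultilinearMap.map_sum g
  rw [h2, Set.ncard_eq_toFinset_card', Finset.cast_card, ← Finset.sum_filter_add_sum_filter_not
    Finset.univ (fun f : V → V => f ∈ parentFunctions G r)]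
  have h3 : ∑ f with f ∉ parentFunctions G r, det (of fun v => g v (f v)) = 0 := by
    refine Finset.sum_eq_zero fun f hf => ?_
    have hf := (Finset.mem_filter.mp hf).2
    by_cases hr : f r = r
    · by_cases ha : ∀ v, v ≠ r → G.Adj v (f v)
      · have : (of fun v => g v (f v)) = rootedMatrix f r := by
          ext v u
          by_cases hv : v = r
          · subst hv; simp [g, rootedMatrix, hr]
          · simp [g, rootedMatrix, hv, ha v hv]
        rw [this]
        exact det_rootedMatrix_of_not_reaches f r fun h => hf ⟨hr, ha, h⟩
      · push Not at ha
        obtain ⟨v, hv, hva⟩ := ha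
        exact det_eq_zero_of_row_eq_zero v fun u => by simp [g, hv, hva]
    · exact det_eq_zero_of_row_eq_zero r fun u => by simp [g, hr]
  rw [h3, add_zero]
  refine Finset.sum_congr (by ext; simp) fun f hf => ?_
  have hf := Set.mem_toFinset.mp hf
  have : (of fun v => g v (f v)) = rootedMatrix f r := by
    ext v u
    by_cases hv : v = r
    · subst hv; simp [g, rootedMatrix, hf.1]
    · simp [g, rootedMatrix, hv, hf.2.1 v hv]
  rw [this, det_rootedMatrix_of_reaches f r hf.2.2]

theorem parentGraph_isTree {G : SimpleGraph V} {r : V} {f : V → V}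
    (hf : f ∈ parentFunctions G r) : (parentGraph f r).IsTree := by
  have hreach : ∀ k v, f^[k] v = r → (parentGraph f r).Reachable v r := by
    intro k
    induction k with
    | zero => rintro v rfl; rfl
    | succ k ih =>
      intro v hv
      by_cases hvr : v = r
      · rw [hvr]
      · exact (parentGraph_adj_parent hf hvr).reachable.trans (ih (f v) hv)
  have hconn : (parentGraph f r).Connected := by
    have : Nonempty V := ⟨r⟩
    refine ⟨fun u v => ?_⟩
    obtain ⟨k, hk⟩ := hf.2.2 u
    obtain ⟨l, hl⟩ := hf.2.2 v
    exact (hreach k u hk).trans (hreach l v hl).symm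
  rw [SimpleGraph.isTree_iff_connected_and_card]
  refine ⟨hconn, le_antisymm ?_ hconn.card_vert_le_card_edgeSet_add_one⟩
  have h1 : (parentGraph f r).edgeSet.ncard ≤ ((fun v => s(v, f v)) '' {v | v ≠ r}).ncard := by
    refine Set.ncard_le_ncard ?_ (Set.toFinite _)
    rw [parentGraph, SimpleGraph.edgeSet_fromEdgeSet]
    exact Set.sdiff_subset
  have h2 : ((fun v => s(v, f v)) '' {v | v ≠ r}).ncard ≤ ({v | v ≠ r} : Set V).ncard :=
    Set.ncard_image_le (Set.toFinite _)
  have h3 : ({v | v ≠ r} : Set V).ncard + 1 = Nat.card V := by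
    have : ({v | v ≠ r} : Set V) = {r}ᶜ := by ext; simp
    rw [this, Set.ncard_compl, Set.ncard_singleton]
    have : 0 < Nat.card V := by
      have : Nonempty V := ⟨r⟩
      exact Nat.card_pos
    omega
  rw [Nat.card_coe_set_eq]
  omega

theorem exists_parentFunction {G T : SimpleGraph V} (hTG : T ≤ G) (hT : T.IsTree) (r : V) :
    ∃ f ∈ parentFunctions G r, parentGraph f r = T := by
  have hstep : ∀ v, ∃ u, v ≠ r → T.Adj v u ∧ T.dist v r = T.dist u r + 1 := by
    intro v
    by_cases hv : v = r
    · exact ⟨v, fun h => absurd hv h⟩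
    obtain ⟨p, hp⟩ := hT.connected.exists_walk_length_eq_dist v r
    cases p with
    | nil => exact absurd rfl hv
    | @cons _ u _ h q =>
      refine ⟨u, fun _ => ⟨h, ?_⟩⟩
      rw [SimpleGraph.Walk.length_cons] at hp
      have h1 := SimpleGraph.dist_le q
      have h2 : T.dist v r ≤ T.dist v u + T.dist u r := hT.connected.dist_triangle
      have h3 : T.dist v u = 1 := SimpleGraph.dist_eq_one_iff_adj.mpr h
      omega
  choose s hs using hstep
  let f : V → V := fun v => if v = r then r else s v
  have hfr : f r = r := if_pos rfl
  have hfv : ∀ v, v ≠ r → T.Adj v (f v) ∧ T.dist v r = T.dist (f v) r + 1 := by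
    intro v hv
    simp only [f, if_neg hv]
    exact hs v hv
  have hreach : ∀ n v, T.dist v r = n → ∃ k, f^[k] v = r := by
    intro n
    induction n with
    | zero =>
      intro v hv
      exact ⟨0, (hT.connected.dist_eq_zero_iff).mp hv⟩
    | succ n ih =>
      intro v hv
      have hvr : v ≠ r := by
        rintro rfl
        simp at hv
      obtain ⟨k, hk⟩ := ih (f v) (by have := (hfv v hvr).2; omega)
      exact ⟨k + 1, hk⟩
  have hfT : f ∈ parentFunctions T r := ⟨hfr, fun v hv => (hfv v hv).1, fun v => hreach _ v rfl⟩
  refine ⟨f, ⟨hfr, fun v hv => hTG (hfv v hv).1, hfT.2.2⟩, ?_⟩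
  -- The steps towards `r` form a connected subgraph of `T`, and a tree is minimal connected.
  exact (SimpleGraph.isTree_iff_minimal_connected.mp hT).eq_of_le
    (parentGraph_isTree hfT).connected (parentGraph_le hfT)

theorem numSpanningTrees_eq_ncard_parentFunctions (G : SimpleGraph V) (r : V) :
    numSpanningTrees G = (parentFunctions G r).ncard := by
  rw [numSpanningTrees, ← (parentGraph_injOn G r).ncard_image]
  congr 1
  ext T
  constructor
  · rintro ⟨h1, h2⟩
    exact exists_parentFunction h1 h2 r
  · rintro ⟨f, hf, rfl⟩
    exact ⟨parentGraph_le hf, parentGraph_isTree hf⟩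

theorem lap_row_sum (G : SimpleGraph V) (i : V) : ∑ j, lap G i j = 0 := by
  simp [lap_apply, Finset.sum_sub_distrib]

theorem lap_symm (G : SimpleGraph V) (i j : V) : lap G i j = lap G j i :=
  (G.isSymm_lapMatrix (R := ℝ)).apply j i

/-- Kirchhoff's matrix tree theorem. -/
theorem det_lap_add_one [Nonempty V] (G : SimpleGraph V) :
    (lap G + of fun _ _ => 1).det = (Fintype.card V : ℝ) ^ 2 * numSpanningTrees G := by
  obtain ⟨r⟩ := ‹Nonempty V›
  rw [det_add_one_of_sum_eq_zero (lap G) (lap_row_sum G)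
    (fun j => by simp_rw [lap_symm G _ j]; exact lap_row_sum G j) r, det_updateRow_lap,
    numSpanningTrees_eq_ncard_parentFunctions G r]

theorem lap_compl (G : SimpleGraph V) :
    lap Gᶜ + of (fun _ _ => 1) = (Fintype.card V : ℝ) • (1 : Matrix V V ℝ) - lap G := by
  have hc : ∀ i j, @ite ℝ (Gᶜ.Adj i j) (Classical.propDecidable _) 1 0 =
      1 - (if i = j then 1 else 0) - if G.Adj i j then 1 else 0 := by
    intro i j
    by_cases h : i = j
    · subst h; simp
    · by_cases h' : G.Adj i j <;> simp [h, h']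
  ext i j
  rw [Matrix.add_apply, Matrix.sub_apply, lap_apply, lap_apply, Matrix.smul_apply, one_apply, of_apply]
  simp only [hc, Finset.sum_sub_distrib]
  by_cases h : i = j
  · subst h; simp; ring
  · simp [h]

theorem det_card_sub_lap [Nonempty V] (G : SimpleGraph V) :
    ((Fintype.card V : ℝ) • (1 : Matrix V V ℝ) - lap G).det =
      (Fintype.card V : ℝ) ^ 2 * numSpanningTrees Gᶜ := by
  rw [← lap_compl, det_lap_add_one]

end MatrixTree

/-! ### Comparing products and power sums of real families. -/

section PowerSums

open Finset

theorem log_one_sub_le_neg_sum {x : ℝ} (h0 : 0 ≤ x) (h1 : x < 1) (m : ℕ) :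
    Real.log (1 - x) ≤ -∑ i ∈ range m, x ^ (i + 1) / (i + 1) := by
  have h := Real.hasSum_pow_div_log_of_abs_lt_one (x := x) (by rwa [abs_of_nonneg h0])
  have := sum_le_hasSum (range m) (fun i _ => by positivity) h
  linarith

theorem neg_sum_sub_le_log_one_sub {x : ℝ} (h0 : 0 ≤ x) (h1 : x ≤ 1 / 2) (m : ℕ) :
    -∑ i ∈ range m, x ^ (i + 1) / (i + 1) - 2 * x ^ (m + 1) ≤ Real.log (1 - x) := by
  have h := Real.abs_log_sub_add_sum_range_le (x := x) (by rw [abs_of_nonneg h0]; linarith) m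
  rw [abs_of_nonneg h0] at h
  have h2 : x ^ (m + 1) / (1 - x) ≤ 2 * x ^ (m + 1) := by
    rw [div_le_iff₀ (by linarith)]
    nlinarith [pow_nonneg h0 (m + 1)]
  linarith [(abs_le.mp h).1]

/-- If the power sums of `x` and `y` first differ at the exponent `j`, with that of `x` larger,
then `∏ (n - x i) < ∏ (n - y i)` as soon as `n` is large in terms of `j` and bounds on `y`. -/
theorem prod_sub_lt_prod_sub {ι : Type*} [Fintype ι] {x y : ι → ℝ} {n A B c : ℝ} {j : ℕ}
    (hn : n = Fintype.card ι) (hn1 : 1 ≤ n) (hx0 : ∀ i, 0 ≤ x i) (hxn : ∀ i, x i ≤ n)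
    (hy0 : ∀ i, 0 ≤ y i) (hyB : ∀ i, y i ≤ B) (hc : 0 ≤ c)
    (heq : ∀ k, 1 ≤ k → k < j + 2 → ∑ i, x i ^ k = ∑ i, y i ^ k)
    (hlt : ∑ i, y i ^ (j + 2) + 1 ≤ ∑ i, x i ^ (j + 2))
    (hA : ∑ i, y i ^ (j + 1) * (y i - c) ^ 2 ≤ A)
    (hnB : 2 * B ≤ n) (hnA : (j + 2) * (A + 2 * B ^ (j + 4)) < n) :
    ∏ i, (n - x i) < ∏ i, (n - y i) := by
  have hn0 : 0 < n := by linarith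
  have hypos : ∀ i, 0 < n - y i := fun i => by linarith [hyB i]
  -- Logarithms need `x i < n`; if equality occurs, the left product vanishes.
  by_cases hxe : ∃ i, x i = n
  · obtain ⟨i, hi⟩ := hxe
    rw [Finset.prod_eq_zero (mem_univ i) (by rw [hi, sub_self])]
    exact Finset.prod_pos fun i _ => hypos i
  push Not at hxe
  have hxlt : ∀ i, x i < n := fun i => lt_of_le_of_ne (hxn i) (hxe i)
  have hxpos : ∀ i, 0 < n - x i := fun i => by linarith [hxlt i]
  rw [← Real.log_lt_log_iff (Finset.prod_pos fun i _ => hxpos i)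
    (Finset.prod_pos fun i _ => hypos i), Real.log_prod (fun i _ => (hxpos i).ne'),
    Real.log_prod (fun i _ => (hypos i).ne')]
  have hlog : ∀ z : ℝ, 0 < n - z → Real.log (n - z) = Real.log n + Real.log (1 - z / n) := by
    intro z hz
    rw [← Real.log_mul hn0.ne' (by rw [one_sub_div hn0.ne']; positivity)]
    congr 1
    field_simp
  -- Discarding the tail needs only `0 ≤ x i < n`: every discarded term is nonpositive.
  have hX : ∑ i, Real.log (n - x i) ≤ ∑ _i : ι, Real.log n -
      ∑ k ∈ range (j + 3), (∑ i, x i ^ (k + 1)) / (n ^ (k + 1) * (k + 1)) := by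
    simp_rw [Finset.sum_div]
    rw [Finset.sum_comm, ← Finset.sum_sub_distrib]
    refine Finset.sum_le_sum fun i _ => ?_
    rw [hlog _ (hxpos i)]
    have := log_one_sub_le_neg_sum (div_nonneg (hx0 i) hn0.le)
      ((div_lt_one hn0).mpr (hxlt i)) (j + 3)
    simp_rw [div_pow, div_div] at this
    linarith
  have hY : ∑ _i : ι, Real.log n -
      ∑ k ∈ range (j + 3), (∑ i, y i ^ (k + 1)) / (n ^ (k + 1) * (k + 1)) -
        n * (2 * (B / n) ^ (j + 4)) ≤ ∑ i, Real.log (n - y i) := by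
    have hcard : n * (2 * (B / n) ^ (j + 4)) = ∑ _i : ι, 2 * (B / n) ^ (j + 4) := by
      rw [Finset.sum_const, card_univ, nsmul_eq_mul, hn]
    rw [hcard]
    simp_rw [Finset.sum_div]
    rw [Finset.sum_comm, ← Finset.sum_sub_distrib, ← Finset.sum_sub_distrib]
    refine Finset.sum_le_sum fun i _ => ?_
    rw [hlog _ (hypos i)]
    have h0 := div_nonneg (hy0 i) hn0.le
    have := neg_sum_sub_le_log_one_sub h0
      ((div_le_iff₀ hn0).mpr (by linarith [hyB i])) (j + 3)
    simp_rw [div_pow (y i) n (_ + 1), div_div] at this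
    have h3 : (y i / n) ^ (j + 4) ≤ (B / n) ^ (j + 4) := by
      gcongr
      exact hyB i
    have h4 : (y i / n) ^ (j + 4) = y i ^ (j + 3 + 1) / n ^ (j + 3 + 1) := div_pow _ _ _
    linarith
  refine hX.trans_lt (lt_of_lt_of_le ?_ hY)
  rw [sum_range_succ, sum_range_succ, sum_range_succ _ (j + 2), sum_range_succ _ (j + 1)]
  have hlow : ∑ k ∈ range (j + 1), (∑ i, x i ^ (k + 1)) / (n ^ (k + 1) * (k + 1)) =
      ∑ k ∈ range (j + 1), (∑ i, y i ^ (k + 1)) / (n ^ (k + 1) * (k + 1)) := by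
    refine Finset.sum_congr rfl fun k hk => ?_
    rw [heq (k + 1) (by omega) (by have := mem_range.mp hk; omega)]
  rw [hlow]
  have hexp : ∀ z : ι → ℝ, ∑ i, z i ^ (j + 1) * (z i - c) ^ 2 =
      ∑ i, z i ^ (j + 3) - 2 * c * ∑ i, z i ^ (j + 2) + c ^ 2 * ∑ i, z i ^ (j + 1) := by
    intro z
    rw [mul_sum, mul_sum, ← sum_sub_distrib, ← sum_add_distrib]
    exact sum_congr rfl fun i _ => by ring
  have hx2 : 0 ≤ ∑ i, x i ^ (j + 1) * (x i - c) ^ 2 :=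
    sum_nonneg fun i _ => mul_nonneg (pow_nonneg (hx0 i) _) (sq_nonneg _)
  rw [hexp] at hx2 hA
  rw [heq (j + 1) (by omega) (by omega)] at hx2
  set X2 := ∑ i, x i ^ (j + 2)
  set Y2 := ∑ i, y i ^ (j + 2)
  -- Subtract the two expanded moments: the sums of exponent `j + 1` cancel, and the middle term
  -- helps since `c ≥ 0` and `Y2 ≤ X2`.
  have h3 : -A ≤ ∑ i, x i ^ (j + 3) - ∑ i, y i ^ (j + 3) := by nlinarith
  set X3 := ∑ i, x i ^ (j + 3)
  set Y3 := ∑ i, y i ^ (j + 3)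
  have hX2 : Y2 / (n ^ (j + 2) * ((j + 1 : ℕ) + 1)) + 1 / (n ^ (j + 2) * ((j + 1 : ℕ) + 1)) ≤
      X2 / (n ^ (j + 2) * ((j + 1 : ℕ) + 1)) := by
    rw [← add_div]
    gcongr
  have hX3 : Y3 / (n ^ (j + 3) * ((j + 2 : ℕ) + 1)) - A / (n ^ (j + 3) * ((j + 2 : ℕ) + 1)) ≤
      X3 / (n ^ (j + 3) * ((j + 2 : ℕ) + 1)) := by
    rw [← sub_div]
    gcongr
    linarith
  have hA0 : 0 ≤ A := by
    rw [← hexp] at hA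
    exact (sum_nonneg fun i _ => mul_nonneg (pow_nonneg (hy0 i) _) (sq_nonneg _)).trans hA
  have hA3 : A / (n ^ (j + 3) * ((j + 2 : ℕ) + 1)) ≤ A / n ^ (j + 3) := by
    apply div_le_div_of_nonneg_left hA0 (by positivity)
    have : (0 : ℝ) ≤ ((j + 2 : ℕ) : ℝ) := by positivity
    nlinarith [pow_pos hn0 (j + 3)]
  have hfin : A / n ^ (j + 3) + n * (2 * (B / n) ^ (j + 4)) <
      1 / (n ^ (j + 2) * ((j + 1 : ℕ) + 1)) := by
    have e1 : A / n ^ (j + 3) + n * (2 * (B / n) ^ (j + 4)) =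
        (A + 2 * B ^ (j + 4)) / n ^ (j + 3) := by
      rw [div_pow]
      field_simp
      ring
    rw [e1, div_lt_div_iff₀ (by positivity) (by positivity)]
    push_cast
    have : (A + 2 * B ^ (j + 4)) * (n ^ (j + 2) * (j + 1 + 1)) =
        n ^ (j + 2) * ((j + 2) * (A + 2 * B ^ (j + 4))) := by ring
    rw [this, one_mul, pow_succ n (j + 2)]
    gcongr
  simp only [Nat.reduceAdd, add_assoc] at *
  linarith

/-- Two finite families of reals with few distinct nonzero values have equal power sums as soon
as finitely many of these agree. -/
theorem sum_pow_eq_of_forall_le {ι : Type*} [Fintype ι] {x y : ι → ℝ} {D : ℕ} (S : Finset ℝ)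
    (hx : ∀ i, x i ∈ S) (hy : ∀ i, y i ∈ S) (hS : #S ≤ D)
    (heq : ∀ k, 1 ≤ k → k ≤ D → ∑ i, x i ^ k = ∑ i, y i ^ k) (k : ℕ) :
    ∑ i, x i ^ k = ∑ i, y i ^ k := by
  classical
  rcases Nat.eq_zero_or_pos k with rfl | hk
  · simp
  -- On `S` the power `z ^ k` is a polynomial of degree at most `D`, so the `k`-th power sum is a
  -- fixed combination of lower ones.
  let P := Lagrange.interpolate S id (fun z : ℝ => z ^ k)
  have hP : ∀ z ∈ S, P.eval z = z ^ k := fun z hz =>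
    Lagrange.eval_interpolate_at_node (v := id) _ (Set.injOn_id _) hz
  have hdeg : P.natDegree < D + 1 := by
    have h := Lagrange.degree_interpolate_lt (s := S) (v := id) (fun z : ℝ => z ^ k)
      (Set.injOn_id _)
    have h' : P.degree < (D + 1 : ℕ) := h.trans (by exact_mod_cast Nat.lt_succ_of_le hS)
    by_cases hP0 : P = 0
    · rw [hP0]; simp
    · exact (Polynomial.natDegree_lt_iff_degree_lt hP0).mpr h'
  have hsum : ∀ z : ι → ℝ, (∀ i, z i ∈ S) →
      ∑ i, z i ^ k = ∑ m ∈ range (D + 1), P.coeff m * ∑ i, z i ^ m := by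
    intro z hz
    simp_rw [mul_sum]
    rw [sum_comm]
    refine sum_congr rfl fun i _ => ?_
    rw [← hP _ (hz i), Polynomial.eval_eq_sum_range' hdeg]
  rw [hsum x hx, hsum y hy]
  refine sum_congr rfl fun m hm => ?_
  rcases Nat.eq_zero_or_pos m with rfl | hm0
  · simp
  · rw [heq m hm0 (by have := mem_range.mp hm; omega)]

end PowerSums

/-! ### Laplacian eigenvalues, integrality and the defect. -/

section Spectrum

open scoped Classical
open Matrix

variable {V : Type*} [Fintype V]

theorem lap_posSemidef (G : SimpleGraph V) : (lap G).PosSemidef :=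
  G.posSemidef_lapMatrix ℝ

theorem lap_isHermitian (G : SimpleGraph V) : (lap G).IsHermitian :=
  (lap_posSemidef G).isHermitian

/-- The Laplacian eigenvalues of a graph, with multiplicity. -/
noncomputable def lapEig (G : SimpleGraph V) : V → ℝ := (lap_isHermitian G).eigenvalues

theorem exists_lap_eq_conj (G : SimpleGraph V) : ∃ u : unitary (Matrix V V ℝ),
    lap G = Unitary.conjStarAlgAut ℝ _ u (diagonal (lapEig G)) :=
  ⟨_, (lap_isHermitian G).spectral_theorem⟩

theorem trace_conjStarAlgAut (u : unitary (Matrix V V ℝ)) (M : Matrix V V ℝ) :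
    (Unitary.conjStarAlgAut ℝ _ u M).trace = M.trace := by
  rw [Unitary.conjStarAlgAut_apply, trace_mul_comm, ← mul_assoc, Unitary.coe_star_mul_self,
    one_mul]

theorem det_conjStarAlgAut (u : unitary (Matrix V V ℝ)) (M : Matrix V V ℝ) :
    (Unitary.conjStarAlgAut ℝ _ u M).det = M.det := by
  rw [Unitary.conjStarAlgAut_apply, det_mul_comm, ← mul_assoc, Unitary.coe_star_mul_self,
    one_mul]

theorem rank_conjStarAlgAut (u : unitary (Matrix V V ℝ)) (M : Matrix V V ℝ) :
    M.rank ≤ (Unitary.conjStarAlgAut ℝ _ u M).rank := by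
  have h : M = star (u : Matrix V V ℝ) * (Unitary.conjStarAlgAut ℝ _ u M * u) := by
    rw [Unitary.conjStarAlgAut_apply, mul_assoc, Unitary.coe_star_mul_self, mul_one, ← mul_assoc,
      Unitary.coe_star_mul_self, one_mul]
  calc M.rank = (star (u : Matrix V V ℝ) * (Unitary.conjStarAlgAut ℝ _ u M * u)).rank := by rw [← h]
    _ ≤ (Unitary.conjStarAlgAut ℝ _ u M * (u : Matrix V V ℝ)).rank := rank_mul_le_right _ _
    _ ≤ _ := rank_mul_le_left _ _

theorem lapSeq_eq_sum (G : SimpleGraph V) (k : ℕ) : lapSeq G k = ∑ i, lapEig G i ^ k := by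
  obtain ⟨u, hu⟩ := exists_lap_eq_conj G
  change (lap G ^ k).trace = _
  rw [hu, ← map_pow, trace_conjStarAlgAut, diagonal_pow, trace_diagonal]
  rfl

theorem det_smul_one_sub_lap (G : SimpleGraph V) (t : ℝ) :
    (t • (1 : Matrix V V ℝ) - lap G).det = ∏ i, (t - lapEig G i) := by
  obtain ⟨u, hu⟩ := exists_lap_eq_conj G
  rw [hu, ← map_one (Unitary.conjStarAlgAut ℝ _ u), ← map_smul, ← map_sub, det_conjStarAlgAut, ← diagonal_one, ← diagonal_smul, diagonal_sub, det_diagonal]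
  simp

theorem lapEig_nonneg (G : SimpleGraph V) (i : V) : 0 ≤ lapEig G i :=
  (lap_posSemidef G).eigenvalues_nonneg i

theorem lapEig_le_card (G : SimpleGraph V) (i : V) : lapEig G i ≤ Fintype.card V := by
  have hp : ((Fintype.card V : ℝ) • (1 : Matrix V V ℝ) - lap G).PosSemidef := by
    rw [← lap_compl]
    have hJ : (of fun _ _ : V => (1 : ℝ)) = vecMulVec (fun _ => 1) (star fun _ => 1) := by
      ext i j
      simp [vecMulVec_apply]
    rw [hJ]
    exact (lap_posSemidef Gᶜ).add (posSemidef_vecMulVec_self_star _)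
  set v : V → ℝ := ((lap_isHermitian G).eigenvectorBasis i).ofLp
  have h1 : lap G *ᵥ v = lapEig G i • v := (lap_isHermitian G).mulVec_eigenvectorBasis i
  have h2 : v ⬝ᵥ v ≠ 0 := by
    rw [Ne, dotProduct_self_eq_zero]
    intro h
    apply (lap_isHermitian G).eigenvectorBasis.orthonormal.ne_zero i
    ext k
    exact congrFun h k
  have h3 : 0 ≤ v ⬝ᵥ v := Finset.sum_nonneg fun k _ => mul_self_nonneg _
  have h4 := hp.dotProduct_mulVec_nonneg v
  rw [sub_mulVec, h1, smul_mulVec, one_mulVec, star_trivial, dotProduct_sub, dotProduct_smul,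
    dotProduct_smul, smul_eq_mul, smul_eq_mul, ← sub_mul] at h4
  have h5 : 0 < v ⬝ᵥ v := lt_of_le_of_ne h3 (Ne.symm h2)
  linarith [nonneg_of_mul_nonneg_left h4 h5]

/-- The rank of an integral positive semidefinite matrix is at most its trace. -/
theorem rank_le_trace_of_posSemidef {M : Matrix V V ℝ} (hM : M.PosSemidef)
    (hint : ∀ i, ∃ z : ℤ, M i i = z) : (M.rank : ℝ) ≤ M.trace := by
  have hd : ∀ i, 0 ≤ M i i := fun i => hM.diag_nonneg
  let s : V → ℝ := fun i => if M i i = 0 then 0 else 1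
  -- A zero diagonal entry of a positive semidefinite matrix kills its column. So the rank is at
  -- most the number of nonzero diagonal entries, each at least `1` by integrality.
  have hrow : M = M * diagonal s := by
    ext i j
    rw [mul_diagonal]
    by_cases h : M j j = 0
    · have : M *ᵥ Pi.single j 1 = 0 := by
        rw [← hM.dotProduct_mulVec_zero_iff]
        simp [h]
      have := congrFun this i
      simp at this
      simp [s, h, this]
    · simp [s, h]
  have h1 : M.rank ≤ (diagonal s).rank := by
    conv_lhs => rw [hrow]
    exact rank_mul_le_right _ _
  rw [rank_diagonal, Fintype.card_subtype] at h1
  have h2 : ((Finset.univ.filter fun i => s i ≠ 0).card : ℝ) = ∑ i, s i := by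
    rw [Finset.cast_card, Finset.sum_filter]
    refine Finset.sum_congr rfl fun i _ => ?_
    by_cases h : M i i = 0 <;> simp [s, h]
  calc (M.rank : ℝ) ≤ ((Finset.univ.filter fun i => s i ≠ 0).card : ℝ) := by exact_mod_cast h1
    _ = ∑ i, s i := h2
    _ ≤ ∑ i, M i i := Finset.sum_le_sum fun i _ => by
      by_cases h : M i i = 0
      · simp [s, h]
      · obtain ⟨z, hz⟩ := hint i
        have h0 := lt_of_le_of_ne (hd i) (Ne.symm h)
        simp only [s, h, if_false]
        rw [hz] at h0 ⊢
        exact_mod_cast h0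

/-- The integral Laplacian matrix of a graph. -/
noncomputable def intLap (G : SimpleGraph V) : Matrix V V ℤ := G.lapMatrix ℤ

theorem map_intLap (G : SimpleGraph V) : (Int.castRingHom ℝ).mapMatrix (intLap G) = lap G := by
  ext i j
  simp [intLap, lap, SimpleGraph.lapMatrix, SimpleGraph.degMatrix, diagonal_apply,
    SimpleGraph.adjMatrix_apply, apply_ite (Int.cast : ℤ → ℝ)]

theorem exists_int_lapSeq (G : SimpleGraph V) (k : ℕ) : ∃ z : ℤ, lapSeq G k = z := by
  refine ⟨(intLap G ^ k).trace, ?_⟩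
  change (lap G ^ k).trace = _
  rw [← map_intLap, ← map_pow]
  simp [trace]

theorem lapSeq_add_one_le {G : SimpleGraph V} {W : Type*} [Fintype W] {H : SimpleGraph W} {k : ℕ}
    (h : lapSeq G k < lapSeq H k) : lapSeq G k + 1 ≤ lapSeq H k := by
  obtain ⟨a, ha⟩ := exists_int_lapSeq G k
  obtain ⟨b, hb⟩ := exists_int_lapSeq H k
  rw [ha, hb] at h ⊢
  exact_mod_cast h

/-- The third moment `tr (L (L - c)²)` of the Laplacian, weighted to vanish at `0` and `c`. -/
noncomputable def lapDefect (G : SimpleGraph V) (c : ℝ) : ℝ :=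
  ∑ i, lapEig G i * (lapEig G i - c) ^ 2

/-- The count is the rank of `(L - c) L (L - c)`, which is integral and positive semidefinite with
trace the defect. -/
theorem card_lapEig_le (G : SimpleGraph V) (c : ℕ) :
    ((Finset.univ.filter fun i => lapEig G i ≠ 0 ∧ lapEig G i ≠ c).card : ℝ) ≤
      lapDefect G c := by
  set K : Matrix V V ℝ := lap G - (c : ℝ) • 1 with hK
  set M : Matrix V V ℝ := Kᴴ * lap G * K with hM
  have hKh : Kᴴ = K := by
    rw [hK, conjTranspose_sub, (lap_isHermitian G).eq]
    simp
  have hMp : M.PosSemidef := (lap_posSemidef G).conjTranspose_mul_mul_same K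
  have hMint : ∀ i, ∃ z : ℤ, M i i = z := by
    intro i
    have : M = (Int.castRingHom ℝ).mapMatrix
        ((intLap G - (c : ℤ) • 1) * intLap G * (intLap G - (c : ℤ) • 1)) := by
      rw [map_mul, map_mul, map_sub, map_intLap, hM, hKh, hK]
      have : (Int.castRingHom ℝ).mapMatrix ((c : ℤ) • (1 : Matrix V V ℤ)) = (c : ℝ) • 1 := by
        rw [map_zsmul, map_one, natCast_zsmul, Nat.cast_smul_eq_nsmul]
      rw [this]
    exact ⟨_, by rw [this]; rfl⟩
  obtain ⟨u, hu⟩ := exists_lap_eq_conj G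
  have hMd : M = Unitary.conjStarAlgAut ℝ _ u
      (diagonal fun i => lapEig G i * (lapEig G i - c) ^ 2) := by
    have hKd : K = Unitary.conjStarAlgAut ℝ _ u
        (diagonal fun i => lapEig G i - c) := by
      rw [hK, hu, ← map_one (Unitary.conjStarAlgAut ℝ _ u), ← map_smul, ← map_sub, ← diagonal_one, ← diagonal_smul, diagonal_sub]
      simp
    rw [hM, hKh, hKd, hu, ← map_mul, ← map_mul, diagonal_mul_diagonal, diagonal_mul_diagonal]
    congr 2
    ext i
    ring
  have h1 := rank_le_trace_of_posSemidef hMp hMint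
  have h2 : (diagonal fun i => lapEig G i * (lapEig G i - c) ^ 2).rank ≤ M.rank := by
    rw [hMd]
    exact rank_conjStarAlgAut _ _
  have h3 : M.trace = lapDefect G c := by
    rw [hMd, trace_conjStarAlgAut, trace_diagonal, lapDefect]
  rw [rank_diagonal, Fintype.card_subtype] at h2
  rw [← h3]
  refine le_trans ?_ h1
  have h4 : (Finset.univ.filter fun i => lapEig G i ≠ 0 ∧ lapEig G i ≠ c) =
      Finset.univ.filter fun i => lapEig G i * (lapEig G i - c) ^ 2 ≠ 0 := by
    ext i
    simp [sub_eq_zero]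
  rw [h4]
  exact_mod_cast h2

theorem lapDefect_eq (G : SimpleGraph V) (c : ℝ) :
    lapDefect G c = lapSeq G 3 - 2 * c * lapSeq G 2 + c ^ 2 * lapSeq G 1 := by
  simp_rw [lapSeq_eq_sum, lapDefect]
  rw [Finset.mul_sum, Finset.mul_sum, ← Finset.sum_sub_distrib, ← Finset.sum_add_distrib]
  exact Finset.sum_congr rfl fun i _ => by ring

/-- An eigenvalue above `c + 1` is at most its own term in the defect. -/
theorem lapEig_le_of_lapDefect (G : SimpleGraph V) {c : ℝ} (hc : 0 ≤ c) (i : V) :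
    lapEig G i ≤ c + 1 + lapDefect G c := by
  have hnn : ∀ j, 0 ≤ lapEig G j * (lapEig G j - c) ^ 2 := fun j =>
    mul_nonneg (lapEig_nonneg G j) (sq_nonneg _)
  have h : lapEig G i * (lapEig G i - c) ^ 2 ≤ lapDefect G c :=
    Finset.single_le_sum (f := fun j => lapEig G j * (lapEig G j - c) ^ 2) (fun j _ => hnn j)
      (Finset.mem_univ i)
  by_contra! hlt
  have h0 := (hnn i).trans h
  have h1 : 1 ≤ (lapEig G i - c) ^ 2 := by nlinarith
  nlinarith [lapEig_nonneg G i]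

end Spectrum

/-! ### Traces of graphs, complete components and the comparison. -/

section GraphMoments

open scoped Classical
open Matrix

variable {V W : Type*} [Fintype V] [Fintype W]

theorem lapSeq_eq_trace [DecidableEq V] (G : SimpleGraph V) (k : ℕ) :
    lapSeq G k = (lap G ^ k).trace := by
  rw [lapSeq, lap]
  congr!

theorem lap_diag (G : SimpleGraph V) (i : V) : lap G i i = G.degree i := by
  simp [lap, SimpleGraph.lapMatrix, SimpleGraph.degMatrix]

theorem mem_regularClass_iff (G : SimpleGraph V) (d : ℕ) :
    G ∈ regularClass V d ↔ ∀ i, lap G i i = d := by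
  simp_rw [lap_diag, Nat.cast_inj]
  rfl

theorem lapSeq_one (G : SimpleGraph V) : lapSeq G 1 = ∑ i, lap G i i := by
  rw [lapSeq_eq_trace, pow_one]
  rfl

theorem lapSeq_one_eq_ncard (G : SimpleGraph V) : lapSeq G 1 = 2 * G.edgeSet.ncard := by
  rw [lapSeq_one]
  simp_rw [lap_diag]
  rw [← Nat.cast_sum, SimpleGraph.sum_degrees_eq_twice_card_edges,
    ← SimpleGraph.coe_edgeFinset, Set.ncard_coe_finset]
  push_cast
  rfl

theorem lapSeq_two (G : SimpleGraph V) :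
    lapSeq G 2 = ∑ i, lap G i i ^ 2 + ∑ i, lap G i i := by
  rw [lapSeq_eq_trace, pow_two, trace, ← Finset.sum_add_distrib]
  refine Finset.sum_congr rfl fun i _ => ?_
  rw [diag_apply, mul_apply]
  have h1 : ∀ j, lap G i j * lap G j i =
      (if i = j then lap G i i ^ 2 else 0) + if G.Adj i j then 1 else 0 := by
    intro j
    rw [lap_symm G j i]
    by_cases h : i = j
    · subst h; simp [sq]
    · rw [lap_apply]; by_cases h' : G.Adj i j <;> simp [h, h']
  simp_rw [h1, Finset.sum_add_distrib]
  congr 1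
  · simp
  · simp [lap_apply]

/-- Among graphs with the same number of edges, a regular one minimises `ℓ₂`. -/
theorem sum_sq_lap_diag_sub {F G : SimpleGraph V} {d : ℕ} (hG : G ∈ regularClass V d)
    (h1 : lapSeq F 1 = lapSeq G 1) :
    ∑ i, (lap F i i - d) ^ 2 = lapSeq F 2 - lapSeq G 2 := by
  rw [mem_regularClass_iff] at hG
  rw [lapSeq_two, lapSeq_two, ← lapSeq_one, ← lapSeq_one, h1]
  have h2 : ∑ i, (lap F i i - d) ^ 2 =
      ∑ i, lap F i i ^ 2 - 2 * d * lapSeq F 1 + ∑ _i : V, (d : ℝ) ^ 2 := by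
    rw [lapSeq_one, Finset.mul_sum, ← Finset.sum_sub_distrib, ← Finset.sum_add_distrib]
    exact Finset.sum_congr rfl fun i _ => by ring
  have h3 : lapSeq G 1 = ∑ _i : V, (d : ℝ) := by
    rw [lapSeq_one]
    exact Finset.sum_congr rfl fun i _ => hG i
  rw [h2, h1, h3]
  simp only [hG, Finset.sum_const, nsmul_eq_mul]
  ring

theorem mem_regularClass_of_lapSeq_eq {F G : SimpleGraph V} {d : ℕ} (hG : G ∈ regularClass V d)
    (h1 : lapSeq F 1 = lapSeq G 1) (h2 : lapSeq F 2 = lapSeq G 2) : F ∈ regularClass V d := by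
  have h := sum_sq_lap_diag_sub hG h1
  rw [h2, sub_self, Finset.sum_eq_zero_iff_of_nonneg fun i _ => sq_nonneg _] at h
  rw [mem_regularClass_iff]
  intro i
  have := h i (Finset.mem_univ i)
  rw [sq_eq_zero_iff] at this
  linarith

theorem lapSeq_compl_one (G : SimpleGraph V) :
    lapSeq Gᶜ 1 = (Fintype.card V : ℝ) ^ 2 - Fintype.card V - lapSeq G 1 := by
  have h : ∀ i, lap Gᶜ i i + 1 = Fintype.card V - lap G i i := by
    intro i
    have := congrFun (congrFun (lap_compl G) i) i
    simpa using this
  have h' : ∀ i, lap Gᶜ i i = Fintype.card V - 1 - lap G i i := fun i => by linarith [h i]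
  rw [lapSeq_one, lapSeq_one]
  simp only [h', Finset.sum_sub_distrib, Finset.sum_const, Finset.card_univ, nsmul_eq_mul]
  ring

theorem mem_sizeClass_iff (F G : SimpleGraph V) :
    F ∈ sizeClass G ↔ lapSeq F 1 = lapSeq G 1 := by
  rw [lapSeq_one_eq_ncard, lapSeq_one_eq_ncard, sizeClass, Set.mem_ofPred_eq]
  constructor
  · intro h; rw [h]
  · intro h
    have : (F.edgeSet.ncard : ℝ) = G.edgeSet.ncard := by linarith
    exact_mod_cast this

theorem compl_mem_sizeClass {F G : SimpleGraph V} (h : F ∈ sizeClass Gᶜ) : Fᶜ ∈ sizeClass G := by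
  rw [mem_sizeClass_iff, lapSeq_compl_one] at *
  linarith

theorem lap_eq_submatrix {F : SimpleGraph V} {G : SimpleGraph W} (e : F ≃g G) :
    lap F = (lap G).submatrix e e := by
  ext i j
  rw [submatrix_apply, lap_apply, lap_apply, ← Equiv.sum_comp e.toEquiv]
  have h : ∀ a b, G.Adj (e a) (e b) ↔ F.Adj a b := fun a b => e.map_adj_iff
  have h' : ∀ b, G.Adj (e i) (e.toEquiv b) ↔ F.Adj i b := fun b => e.map_adj_iff
  simp only [h, h', EmbeddingLike.apply_eq_iff_eq]

theorem numSpanningTrees_congr [Nonempty V] {F G : SimpleGraph V} (e : F ≃g G) :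
    numSpanningTrees F = numSpanningTrees G := by
  have hF := det_lap_add_one F
  have h : lap F + of (fun _ _ => (1 : ℝ)) = (lap G + of fun _ _ => 1).submatrix e e := by
    rw [lap_eq_submatrix e]
    rfl
  have hdet : ((lap G + of fun _ _ => 1).submatrix e e).det = (lap G + of fun _ _ => 1).det :=
    det_submatrix_equiv_self e.toEquiv _
  rw [h, hdet, det_lap_add_one G] at hF
  have h0 : ((Fintype.card V : ℝ) ^ 2) ≠ 0 := by
    have := Fintype.card_ne_zero (α := V)
    positivity
  exact_mod_cast (mul_left_cancel₀ h0 hF).symm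

/-- An isomorphism of graphs is an isomorphism of their complements. -/
def complIso {F G : SimpleGraph V} (e : F ≃g G) : Fᶜ ≃g Gᶜ where
  toEquiv := e.toEquiv
  map_rel_iff' := by
    intro a b
    have h : G.Adj (e.toEquiv a) (e.toEquiv b) ↔ F.Adj a b := e.map_adj_iff
    rw [SimpleGraph.compl_adj, SimpleGraph.compl_adj, h, e.toEquiv.injective.ne_iff]

theorem lap_sum (G : SimpleGraph V) (H : SimpleGraph W) :
    lap (G.sum H) = fromBlocks (lap G) 0 0 (lap H) := by
  have hl : ∀ i j, (G.sum H).Adj (Sum.inl i) (Sum.inl j) ↔ G.Adj i j := fun _ _ => Iff.rfl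
  have hr : ∀ i j, (G.sum H).Adj (Sum.inr i) (Sum.inr j) ↔ H.Adj i j := fun _ _ => Iff.rfl
  have hlr : ∀ i j, ¬ (G.sum H).Adj (Sum.inl i) (Sum.inr j) := by simp
  have hrl : ∀ i j, ¬ (G.sum H).Adj (Sum.inr i) (Sum.inl j) := by simp
  ext i j
  rw [lap_apply, Fintype.sum_sum_type]
  rcases i with i | i <;> rcases j with j | j <;> simp only [hl, hr, hlr, hrl] <;>
    simp [lap_apply]

theorem lapSeq_sum (G : SimpleGraph V) (H : SimpleGraph W) (k : ℕ) :
    lapSeq (G.sum H) k = lapSeq G k + lapSeq H k := by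
  rw [lapSeq_eq_trace, lapSeq_eq_trace, lapSeq_eq_trace, lap_sum, fromBlocks_diagonal_pow]
  simp [trace, Fintype.sum_sum_type]

theorem lap_completeCopies (p m : ℕ) :
    lap (completeCopies p m) = (m : ℝ) • 1 - of fun x y => if x.1 = y.1 then 1 else 0 := by
  have ha : ∀ x y, @ite ℝ ((completeCopies p m).Adj x y) (Classical.propDecidable _) 1 0 =
      (if x.1 = y.1 then 1 else 0) - if x = y then 1 else 0 := by
    intro x y
    simp only [completeCopies, Prod.ext_iff]
    by_cases h1 : x.1 = y.1 <;> by_cases h2 : x.2 = y.2 <;> simp [h1, h2]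
  ext x y
  rw [lap_apply]
  simp only [ha, Finset.sum_sub_distrib]
  have hm : ∑ y : Fin p × Fin m, (if x.1 = y.1 then (1 : ℝ) else 0) = m := by
    rw [Fintype.sum_prod_type, Finset.sum_comm]
    simp
  rw [hm]
  by_cases h : x = y
  · subst h; simp
  · simp [h]

theorem lap_completeCopies_pow (p m k : ℕ) :
    lap (completeCopies p m) ^ (k + 1) = (m : ℝ) ^ k • lap (completeCopies p m) := by
  have hsq : lap (completeCopies p m) * lap (completeCopies p m) =
      (m : ℝ) • lap (completeCopies p m) := by
    rw [lap_completeCopies]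
    set K : Matrix (Fin p × Fin m) (Fin p × Fin m) ℝ :=
      of fun x y => if x.1 = y.1 then 1 else 0 with hK
    have hKK : K * K = (m : ℝ) • K := by
      ext x y
      rw [mul_apply, Fintype.sum_prod_type]
      by_cases h : x.1 = y.1 <;> simp [hK, h]
    rw [sub_mul, mul_sub, mul_sub, hKK, smul_mul_assoc, one_mul, smul_mul_assoc, one_mul,
      mul_smul_comm, mul_one, sub_self, sub_zero, smul_sub]
  induction k with
  | zero => simp
  | succ k ih => rw [pow_succ, ih, smul_mul_assoc, hsq, smul_smul, pow_succ]

theorem lapSeq_completeCopies (p m k : ℕ) :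
    lapSeq (completeCopies p m) (k + 1) = (m : ℝ) ^ k * lapSeq (completeCopies p m) 1 := by
  rw [lapSeq_eq_trace, lapSeq_eq_trace, lap_completeCopies_pow, trace_smul, pow_one, smul_eq_mul]

theorem sum_lapEig_pow_mul (G : SimpleGraph V) (c : ℝ) (j : ℕ) :
    ∑ i, lapEig G i ^ (j + 1) * (lapEig G i - c) ^ 2 =
      lapSeq G (j + 3) - 2 * c * lapSeq G (j + 2) + c ^ 2 * lapSeq G (j + 1) := by
  simp_rw [lapSeq_eq_sum]
  rw [Finset.mul_sum, Finset.mul_sum, ← Finset.sum_sub_distrib, ← Finset.sum_add_distrib]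
  exact Finset.sum_congr rfl fun i _ => by ring

/-- Adding complete components does not change the moments weighted to vanish at `0` and
`d + 1`. -/
theorem sum_lapEig_addCompleteCopies (G : SimpleGraph V) (d p j : ℕ) :
    ∑ i, lapEig (addCompleteCopies G d p) i ^ (j + 1) *
        (lapEig (addCompleteCopies G d p) i - (d + 1 : ℕ)) ^ 2 =
      ∑ i, lapEig G i ^ (j + 1) * (lapEig G i - (d + 1 : ℕ)) ^ 2 := by
  rw [sum_lapEig_pow_mul, sum_lapEig_pow_mul, addCompleteCopies, lapSeq_sum, lapSeq_sum,
    lapSeq_sum, lapSeq_completeCopies _ _ (j + 2), lapSeq_completeCopies _ _ (j + 1),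
    lapSeq_completeCopies _ _ j]
  ring

theorem lapDefect_addCompleteCopies (G : SimpleGraph V) (d p : ℕ) :
    lapDefect (addCompleteCopies G d p) (d + 1 : ℕ) = lapDefect G (d + 1 : ℕ) := by
  simpa [lapDefect] using sum_lapEig_addCompleteCopies G d p 0

/-- `SeqLexLE` asks only for `≤` before its witness, so the first difference may precede that
witness. -/
theorem SeqLexLE.lt_of_first_ne {b c : ℕ → ℝ} (h : SeqLexLE b c) {k : ℕ} (hk : 1 ≤ k)
    (heq : ∀ i, 1 ≤ i → i < k → b i = c i) (hne : b k ≠ c k) : b k < c k := by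
  rcases h with h | ⟨j, hj, hle, hlt⟩
  · exact absurd (h k hk) hne
  · rcases lt_trichotomy j k with hjk | rfl | hjk
    · exact absurd (heq j hj hjk) hlt.ne
    · exact hlt
    · exact lt_of_le_of_ne (hle k hk hjk) hne

/-- Laplacian sequences of graphs with the same integral defect are determined by boundedly many
terms. -/
theorem lapSeq_eq_of_forall_le {F G : SimpleGraph V} {c D : ℕ}
    (hD : 4 + 2 * ⌊lapDefect G c⌋₊ ≤ D) (heq : ∀ k, 1 ≤ k → k ≤ D → lapSeq F k = lapSeq G k)
    (k : ℕ) : lapSeq F k = lapSeq G k := by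
  have hdef : lapDefect F c = lapDefect G c := by
    rw [lapDefect_eq, lapDefect_eq, heq 1 (by omega) (by omega), heq 2 (by omega) (by omega),
      heq 3 (by omega) (by omega)]
  let T : SimpleGraph V → Finset ℝ := fun H =>
    (Finset.univ.filter fun i => lapEig H i ≠ 0 ∧ lapEig H i ≠ c).image (lapEig H)
  have hT : ∀ H, lapDefect H c = lapDefect G c → (T H).card ≤ ⌊lapDefect G c⌋₊ := by
    intro H hH
    refine Finset.card_image_le.trans (Nat.le_floor ?_)
    rw [← hH]
    exact card_lapEig_le H c
  -- Equal defects allow at most `⌊lapDefect G c⌋₊` further values for each graph, so `2 + 2 *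
  -- ⌊lapDefect G c⌋₊` values suffice.
  let S : Finset ℝ := {0, (c : ℝ)} ∪ (T F ∪ T G)
  have hS : S.card ≤ D := by
    have h1 : S.card ≤ ({0, (c : ℝ)} : Finset ℝ).card + (T F ∪ T G).card :=
      Finset.card_union_le _ _
    have h2 : (T F ∪ T G).card ≤ (T F).card + (T G).card := Finset.card_union_le _ _
    have h3 : ({0, (c : ℝ)} : Finset ℝ).card ≤ 2 := Finset.card_le_two
    have h4 := hT F hdef
    have h5 := hT G rfl
    omega
  have hmem : ∀ H i, lapEig H i ∈ ({0, (c : ℝ)} : Finset ℝ) ∪ T H := by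
    intro H i
    by_cases h0 : lapEig H i = 0
    · simp [h0]
    · by_cases h1 : lapEig H i = c
      · simp [h1]
      · refine Finset.mem_union_right _ (Finset.mem_image_of_mem _ ?_)
        simp [h0, h1]
  rw [lapSeq_eq_sum, lapSeq_eq_sum]
  refine sum_pow_eq_of_forall_le S (fun i => ?_) (fun i => ?_) hS (fun m h1 h2 => ?_) k
  · exact Finset.union_subset_union_right Finset.subset_union_left (hmem F i)
  · exact Finset.union_subset_union_right Finset.subset_union_right (hmem G i)
  · rw [← lapSeq_eq_sum, ← lapSeq_eq_sum]
    exact heq m h1 h2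

theorem numSpanningTrees_compl_lt [Nonempty V] {F G : SimpleGraph V} {c j : ℕ} {A B : ℝ}
    (heq : ∀ k, 1 ≤ k → k < j + 2 → lapSeq F k = lapSeq G k)
    (hlt : lapSeq G (j + 2) < lapSeq F (j + 2))
    (hA : ∑ i, lapEig G i ^ (j + 1) * (lapEig G i - c) ^ 2 ≤ A)
    (hB : ∀ i, lapEig G i ≤ B) (hnB : 2 * B ≤ Fintype.card V)
    (hnA : (j + 2) * (A + 2 * B ^ (j + 4)) < Fintype.card V) :
    numSpanningTrees Fᶜ < numSpanningTrees Gᶜ := by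
  have hn : 0 < Fintype.card V := Fintype.card_pos
  have h := prod_sub_lt_prod_sub (x := lapEig F) (y := lapEig G) (n := Fintype.card V)
    (c := c) rfl (by exact_mod_cast hn) (lapEig_nonneg F) (lapEig_le_card F) (lapEig_nonneg G) hB
    (Nat.cast_nonneg c)
    (by simpa only [lapSeq_eq_sum] using heq)
    (by simpa only [lapSeq_eq_sum] using lapSeq_add_one_le hlt) hA hnB hnA
  rw [← det_smul_one_sub_lap, ← det_smul_one_sub_lap, det_card_sub_lap, det_card_sub_lap] at h
  have hpos : (0 : ℝ) < (Fintype.card V : ℝ) ^ 2 := by positivity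
  exact_mod_cast lt_of_mul_lt_mul_left h hpos.le

/-- Comparison of complements with a unique `L`-trace-minimal regular graph `G` on a sufficiently
large vertex set. -/
theorem iso_or_numSpanningTrees_compl_lt [Nonempty V] {F G : SimpleGraph V} {c D : ℕ}
    {A : ℕ → ℝ} {B : ℝ} (hmin : IsOnlyIn (regularSizeClass G) IsLTraceMinimal G)
    (hF : F ∈ sizeClass G) (hD : 4 + 2 * ⌊lapDefect G c⌋₊ ≤ D)
    (hA : ∀ j, ∑ i, lapEig G i ^ (j + 1) * (lapEig G i - c) ^ 2 ≤ A j)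
    (hB : ∀ i, lapEig G i ≤ B) (hnB : 2 * B ≤ Fintype.card V)
    (hnA : ∀ j < D, (j + 2) * (A j + 2 * B ^ (j + 4)) < Fintype.card V) :
    Nonempty (F ≃g G) ∨ numSpanningTrees Fᶜ < numSpanningTrees Gᶜ := by
  obtain ⟨⟨-, d, hG, hGmin⟩, huniq⟩ := hmin
  have h1 := (mem_sizeClass_iff F G).mp hF
  by_cases hall : ∀ k, 1 ≤ k → lapSeq F k = lapSeq G k
  · left
    have hFr := mem_regularClass_of_lapSeq_eq hG h1 (hall 2 (by norm_num))
    refine huniq F ⟨⟨d, hFr⟩, hF⟩ ⟨d, hFr, fun H hH => ?_⟩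
    rcases hGmin H hH with h | ⟨j, hj, hle, hlt⟩
    · exact Or.inl fun i hi => (hall i hi).trans (h i hi)
    · exact Or.inr ⟨j, hj, fun i hi hij => (hall i hi).trans_le (hle i hi hij),
        (hall j hj).trans_lt hlt⟩
  · right
    push Not at hall
    obtain ⟨hk1, hkne⟩ := Nat.find_spec hall
    have hkmin : ∀ i, 1 ≤ i → i < Nat.find hall → lapSeq F i = lapSeq G i := by
      intro i hi hik
      by_contra h
      exact Nat.find_min hall hik ⟨hi, h⟩
    generalize Nat.find hall = k at hk1 hkne hkmin
    obtain ⟨j, rfl⟩ : ∃ j, k = j + 2 := by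
      have : k ≠ 1 := by rintro rfl; exact hkne h1
      exact ⟨k - 2, by omega⟩
    -- At exponent 2 regularity of `G` decides. Beyond it, equal `ℓ₂` makes `F` regular, so
    -- trace-minimality applies.
    have hlt : lapSeq G (j + 2) < lapSeq F (j + 2) := by
      rcases Nat.eq_zero_or_pos j with rfl | hj
      · have h := sum_sq_lap_diag_sub hG h1
        have h0 : 0 ≤ ∑ i, (lap F i i - d) ^ 2 := Finset.sum_nonneg fun i _ => sq_nonneg _
        refine lt_of_le_of_ne ?_ (Ne.symm hkne)
        rw [Nat.zero_add]
        linarith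
      · have hFr := mem_regularClass_of_lapSeq_eq hG h1 (hkmin 2 (by omega) (by omega))
        exact (hGmin F hFr).lt_of_first_ne hk1 (fun i hi hij => (hkmin i hi hij).symm)
          (Ne.symm hkne)
    have hjD : j < D := by
      by_contra! hDj
      exact hkne (lapSeq_eq_of_forall_le hD (fun k h h' => hkmin k h (by omega)) _)
    exact numSpanningTrees_compl_lt hkmin hlt (hA j) hB hnB (hnA j hjD)

end GraphMoments

theorem corollary4p6 {V : Type*} [Fintype V] (d : ℕ) (G₀ : SimpleGraph V)
    (hG₀ : G₀ ∈ regularClass V d)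
    (hmin : ∀ p : ℕ, IsOnlyIn (regularSizeClass (addCompleteCopies G₀ d p)) IsLTraceMinimal
      (addCompleteCopies G₀ d p)) :
    ∃ n₀ : ℕ, ∀ p : ℕ, n₀ ≤ Fintype.card (V ⊕ (Fin p × Fin (d + 1))) →
      IsOnlyIn (sizeClass (addCompleteCopies G₀ d p)ᶜ) IsTOptimal
        (addCompleteCopies G₀ d p)ᶜ := by
  -- All these constants depend on `G₀` and `d` alone, so a single `n₀` serves every `p`.
  let w := lapDefect G₀ (d + 1 : ℕ)
  let D := 4 + 2 * ⌊w⌋₊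
  let A : ℕ → ℝ := fun j => ∑ i, lapEig G₀ i ^ (j + 1) * (lapEig G₀ i - (d + 1 : ℕ)) ^ 2
  let B : ℝ := (d + 1 : ℕ) + 1 + w
  have hlarge : ∀ᶠ n : ℕ in Filter.atTop, 1 ≤ n ∧ 2 * B ≤ n ∧
      ∀ j ∈ Finset.range D, (j + 2) * (A j + 2 * B ^ (j + 4)) < n := by
    refine (Filter.eventually_ge_atTop 1).and ((tendsto_natCast_atTop_atTop.eventually_ge_atTop
      _).and ((Finset.eventually_all _).mpr fun j _ =>
        tendsto_natCast_atTop_atTop.eventually_gt_atTop _))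
  obtain ⟨n₀, hn₀⟩ := Filter.eventually_atTop.mp hlarge
  refine ⟨n₀, fun p hp => ?_⟩
  obtain ⟨hn1, hnB, hnA⟩ := hn₀ _ hp
  have : Nonempty (V ⊕ (Fin p × Fin (d + 1))) := Fintype.card_pos_iff.mp hn1
  set G := addCompleteCopies G₀ d p with hGdef
  have hw : lapDefect G (d + 1 : ℕ) = w := lapDefect_addCompleteCopies G₀ d p
  have key : ∀ H ∈ sizeClass Gᶜ, Nonempty (H ≃g Gᶜ) ∨
      numSpanningTrees H < numSpanningTrees Gᶜ := by
    intro H hH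
    rw [← compl_compl H]
    refine (iso_or_numSpanningTrees_compl_lt (c := d + 1) (D := D) (A := A) (B := B) (hmin p)
      (compl_mem_sizeClass hH) ?_ (fun j => (sum_lapEig_addCompleteCopies G₀ d p j).le) ?_ hnB
      fun j hj => hnA j (Finset.mem_range.mpr hj)).imp (fun ⟨e⟩ => ⟨complIso e⟩) id
    · rw [hw]
    · intro i
      have := lapEig_le_of_lapDefect G (Nat.cast_nonneg (d + 1)) i
      rwa [hw] at this
  refine ⟨⟨rfl, fun H hH => ?_⟩, fun H hH hopt => ?_⟩
  · rcases key H hH with ⟨⟨e⟩⟩ | h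
    · exact (numSpanningTrees_congr e).le
    · exact h.le
  · rcases key H hH with h | h
    · exact h
    · exact absurd (hopt Gᶜ hH.symm) (not_le.mpr h)
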